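/- Let $U\subseteq\mathbb R^d$, let $I$ be a countable set and, for each $x\in U$, let $G_x=(g(x,y,y'):y,y'\in I)$ be a generator matrix (non-negative off-diagonal entries, zero row sums) having a unique invariant distribution $\pi_x=(\pi(x,y):y\in I)$. Let $(\nu,\mu,F)$ be a coupling mechanism for $(G_x)_{x\in U}$, that is: a constant $\nu\in(0,\infty)$ (the driving rate), a measurable space $E$, a family $\mu=(\mu_x:x\in U)$ of probability measures on $E$ and a measurable function $F:I\times E\to I$ such that $$g(x,y,y')=\nu\,\mu_x(\{v\in E:F(y,v)=y'\}),\qquad x\in U,\ y\neq y'\in I.$$ For $x\in U$ let $N$ be a Poisson process of rate $\nu$ and let $(V_n)_{n\ge1}$ be an independent sequence of i.i.d. random variables of law $\mu_x$. For $y,\bar y\in I$ set $Z_0=y$, $\bar Z_0=\bar y$, $Z_{n+1}=F(Z_n,V_{n+1})$, $\bar Z_{n+1}=F(\bar Z_n,V_{n+1})$, $Y_t=Z_{N(t)}$, $\bar Y_t=\bar Z_{N(t)}$, and let $T_c=\inf\{t\ge0:Y_t=\bar Y_t\}$ be the coupling time. Assume that, for some constant $\tau\in(0,\infty)$, $\mathbb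 E_{(x,y,\bar y)}(T_c)\le\tau$ for all $x\in U$ and $y,\bar y\in I$. Let $W$ be a finite-dimensional real normed space with norm $|\cdot|$ (for example $W=\mathbb R$), let $f:U\times I\to W$ be bounded and measurable, and write $\|f\|_\infty=\sup_{U\times I}|f|$ and $\bar f(x)=\sum_{y\in I}f(x,y)\pi(x,y)$. Then there is a function $\chi_f:U\times I\to W$ which is a corrector for $f$, that is, $$G\chi_f(x,y)=\sum_{y'\in I}g(x,y,y')\chi_f(x,y')=f(x,y)-\bar f(x),\qquad x\in U,\ y\in I,$$ and which satisfies, for all $x,x'\in U$ and $y\in I$, $$|\chi_f(x,y)|\le2\tau\|f\|_\infty,$$ $$|\chi_f(x,y)-\chi_f(x',y)|\le2\tau\sup_{z\in I}|f(x,z)-f(x',z)|+2\nu\tau^2\|f\|_\infty\|\mu_x-\mu_{x'}\|,$$ where $\|\mu_x-\mu_{x'}\|$ is the total variation norm of the signed measure $\mu_x-\mu_{x'}$ (equal to $2\sup_A|\mu_x(A)-\mu_{x'}(A)|$). Moreover, for every reference state $\bar y\in I$, the function $$\chi(x,y)=\mathbb E_{(x,y,\bar y)}\int_0^{T_c}\bigl(f(x,\bar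 Y_t)-f(x,Y_t)\bigr)\,dt$$ is well defined, is a corrector for $f$, and satisfies these two estimates. -/

import Mathlib

open MeasureTheory ProbabilityTheory
open scoped ENNReal

noncomputable section

namespace FastVariable

/-- `g` is the generator matrix of a continuous-time Markov chain on `I` with finite total jump
rates: non-negative off-diagonal entries, and (absolutely convergent) row sums equal to `0`,
so that `-g y y` is the total rate of jumping from `y`. -/
structure IsGeneratorMatrix {I : Type*} (g : I → I → ℝ) : Prop where
  offDiag_nonneg : ∀ y y', y ≠ y' → 0 ≤ g y y'
  hasSum_row : ∀ y, HasSum (fun y' => g y y') 0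

/-- `p` is an invariant distribution for `g`: a probability distribution with `p g = 0`. -/
structure IsInvariantDistribution {I : Type*} (g : I → I → ℝ) (p : I → ℝ) : Prop where
  nonneg : ∀ y, 0 ≤ p y
  hasSum_one : HasSum p 1
  invariant : ∀ y', HasSum (fun y => p y * g y y') 0

/-- A coupling mechanism `(ν, μ, F)` with auxiliary space `E` for a family `g = (G_x)` of
generator matrices on `I`. The last field says that, for `y ≠ y'`,
`g(x, y, y') = ν μ_x({v | F(y, v) = y'})`. -/
structure CouplingMechanism {X I : Type*} [MeasurableSpace I] (E : Type*) [MeasurableSpace E]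
    (g : X → I → I → ℝ) where
  /-- the driving rate -/
  ν : ℝ
  ν_pos : 0 < ν
  /-- the laws of the marks -/
  μ : X → Measure E
  isProbabilityMeasure_μ : ∀ x, IsProbabilityMeasure (μ x)
  /-- the update function -/
  F : I → E → I
  measurable_F : Measurable (Function.uncurry F)
  rate_eq : ∀ x y y', y ≠ y' → g x y y' = ν * (μ x).real {v | F y v = y'}

/-- Total variation norm of the difference of two finite measures, i.e. the total mass of the
total variation of the signed measure `μ₁ - μ₂` (so `2` for mutually singular
probability measures). -/
def tvDist {E : Type*} [MeasurableSpace E] (μ₁ μ₂ : Measure E)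
    [IsFiniteMeasure μ₁] [IsFiniteMeasure μ₂] : ℝ :=
  (μ₁.toSignedMeasure - μ₂.toSignedMeasure).totalVariation.real Set.univ

/-- The counting process with successive holding times `s 0, s 1, …`: the number of arrival times
`s 0 + ⋯ + s n` in `[0, t]`. For i.i.d. exponential holding times of rate `ν` this is
a Poisson process of rate `ν`. -/
def countingProcess (s : ℕ → ℝ) (t : ℝ) : ℕ :=
  Set.ncard {n : ℕ | ∑ k ∈ Finset.range (n + 1), s k ≤ t}

namespace CouplingMechanism

variable {X I E : Type*} [MeasurableSpace I] [MeasurableSpace E] {g : X → I → I → ℝ}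

/-- The underlying probability measure for the parameter `x`: on the space of pairs `(s, v)`, the
holding times `s n` are i.i.d. exponential of rate `ν`, the marks `v n` are i.i.d. of law `μ_x`,
and the two sequences are independent. -/
def law (C : CouplingMechanism E g) (x : X) : Measure ((ℕ → ℝ) × (ℕ → E)) :=
  (Measure.infinitePi fun _ : ℕ => expMeasure C.ν).prod (Measure.infinitePi fun _ : ℕ => C.μ x)

/-- The discrete chain `Z_0 = y`, `Z_{n+1} = F(Z_n, V_{n+1})`, where `V_{n+1}` is the mark `v n`. -/
def jumpChain (C : CouplingMechanism E g) (v : ℕ → E) (y : I) : ℕ → I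
  | 0 => y
  | n + 1 => C.F (C.jumpChain v y n) (v n)

/-- The continuous-time chain `Y_t = Z_{N(t)}` started from `y`. -/
def chain (C : CouplingMechanism E g) (ω : (ℕ → ℝ) × (ℕ → E)) (y : I) (t : ℝ) : I :=
  C.jumpChain ω.2 y (countingProcess ω.1 t)

/-- The coupling time `T_c = inf {t ≥ 0 : Y_t = Ȳ_t}` (infinite if there is no such `t`) of the
chains started from `y` and `ybar`. -/
def couplingTime (C : CouplingMechanism E g) (ω : (ℕ → ℝ) × (ℕ → E)) (y ybar : I) : ℝ≥0∞ :=
  ⨅ (t : ℝ) (_ : 0 ≤ t ∧ C.chain ω y t = C.chain ω ybar t), ENNReal.ofReal t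

/-- The mean coupling time `m(x, y, ȳ)`. -/
def meanCouplingTime (C : CouplingMechanism E g) (x : X) (y ybar : I) : ℝ≥0∞ :=
  ∫⁻ ω, C.couplingTime ω y ybar ∂(C.law x)

/-- The time interval `[0, T_c)`. -/
def beforeCoupling (C : CouplingMechanism E g) (ω : (ℕ → ℝ) × (ℕ → E)) (y ybar : I) : Set ℝ :=
  {t | 0 ≤ t ∧ ENNReal.ofReal t < C.couplingTime ω y ybar}

variable {W : Type*} [NormedAddCommGroup W] [NormedSpace ℝ W]

/-- The random variable `∫_0^{T_c} (f(x, Ȳ_t) - f(x, Y_t)) dt`. -/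
def pathIntegral (C : CouplingMechanism E g) (f : X × I → W) (ybar : I) (x : X) (y : I)
    (ω : (ℕ → ℝ) × (ℕ → E)) : W :=
  ∫ t in C.beforeCoupling ω y ybar, (f (x, C.chain ω ybar t) - f (x, C.chain ω y t))

/-- The function `χ(x, y) = 𝔼 ∫_0^{T_c} (f(x, Ȳ_t) - f(x, Y_t)) dt` with reference state `ybar`. -/
def couplingCorrector (C : CouplingMechanism E g) (f : X × I → W) (ybar : I) (x : X) (y : I) : W :=
  ∫ ω, C.pathIntegral f ybar x y ω ∂(C.law x)

/-- The expectation and the time integral that define `couplingCorrector` exist. -/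
def CorrectorWellDefined (C : CouplingMechanism E g) (f : X × I → W) (ybar : I) : Prop :=
  ∀ x y,
    (∀ᵐ ω ∂(C.law x), IntegrableOn
      (fun t => f (x, C.chain ω ybar t) - f (x, C.chain ω y t)) (C.beforeCoupling ω y ybar)) ∧
    Integrable (C.pathIntegral f ybar x y) (C.law x)

/-- The bounds `‖χ(x, y)‖ ≤ 2 τ ‖f‖_∞` and
`‖χ(x, y) - χ(x', y)‖ ≤ 2 τ sup_z ‖f(x, z) - f(x', z)‖ + 2 ν τ² ‖f‖_∞ ‖μ_x - μ_{x'}‖`. -/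
def CorrectorEstimates (C : CouplingMechanism E g) (τ : ℝ) (f : X × I → W) (χ : X → I → W) :
    Prop :=
  (∀ x y, ‖χ x y‖ ≤ 2 * τ * ⨆ p, ‖f p‖) ∧
  ∀ x x' y,
    haveI := C.isProbabilityMeasure_μ
    ‖χ x y - χ x' y‖ ≤ 2 * τ * (⨆ z, ‖f (x, z) - f (x', z)‖)
      + 2 * C.ν * τ ^ 2 * (⨆ p, ‖f p‖) * tvDist (C.μ x) (C.μ x')

end CouplingMechanism

/-- `χ` is a corrector for `f`: `G χ (x, y) = ∑_{y'} g(x, y, y') χ(x, y') = f(x, y) - f̄(x)`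
with `f̄(x) = ∑_y f(x, y) π(x, y)`. -/
def IsCorrector {X I W : Type*} [NormedAddCommGroup W] [NormedSpace ℝ W]
    (g : X → I → I → ℝ) (π : X → I → ℝ) (f : X × I → W) (χ : X → I → W) : Prop :=
  ∀ x, ∃ fbar : W, HasSum (fun y => π x y • f (x, y)) fbar ∧
    ∀ y, HasSum (fun y' => g x y y' • χ x y') (f (x, y) - fbar)

end FastVariable

end

/-!
Write `P_x h(y) = ∫ h(F(y, v)) dμ_x(v)` for the transition operator of the jump chain, so that the
generator acts on bounded functions as `ν (P_x - 1)` and `P_xⁿ h(y)` is the expectation of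
`h(Z_n)`. Everything is reduced to this operator.

* Almost surely the arrival times increase to infinity, so `T_c` is the sum of the holding times
  spent before the jump chains meet. Holding times and marks are independent, hence the mean of
  `T_c` is `ν⁻¹ ∑ a_n`, with `a_n` the probability that the jump chains started from `y` and `z`
  have not met after `n` steps (`meanCouplingTime_eq_tsum`); thus `∑ a_n ≤ ν τ`. In the same way
  `χ(x, y) = ν⁻¹ ∑ (P_xⁿ f_x(ȳ) - P_xⁿ f_x(y))` (`integrable_and_hasSum_couplingCorrector`), the
  terms after the meeting time being zero because the chains stay together.
* Applying `ν (P_x - 1)` to this series telescopes, and gives `f_x - lim P_xⁿ f_x`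
  (`exists_generator_eq_sub`). The coupling inequality shows that the limit does not depend on the
  starting point, and integrating against the invariant distribution identifies it with the mean
  of `f_x` (`hasSum_smul_of_tendsto`).
* Both estimates follow from one stability fact (`norm_sub_le_of_generator`): if `ν (P_x - 1) δ` has
  oscillation at most `K`, then `δ` has oscillation at most `τ K`. With `δ = χ_x` and
  `K = 2 ‖f‖` it gives the uniform bound. With `δ = χ_x - χ_{x'}`, the image of `δ` is, up to a
  constant, `f_x - f_{x'} - ν (P_x - P_{x'}) χ_{x'}`, and the last term is at most
  `ν ‖μ_x - μ_{x'}‖ / 2` times the oscillation `2 τ ‖f‖` of `χ_{x'}`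
  (`norm_integral_sub_le_tvDist`); working with the oscillation in place of the supremum
  is what produces the constant `2 ν τ²`.
-/

noncomputable section

open Filter Topology Set

namespace FastVariable

/-! ### Arrival times and the counting process -/

/-- The arrival time `s 0 + ⋯ + s (n - 1)`: the time at which the `n`-th holding time begins. -/
def arrivalTime (s : ℕ → ℝ) (n : ℕ) : ℝ := ∑ k ∈ Finset.range n, s k

lemma arrivalTime_zero (s : ℕ → ℝ) : arrivalTime s 0 = 0 := by simp [arrivalTime]

lemma arrivalTime_succ (s : ℕ → ℝ) (n : ℕ) : arrivalTime s (n + 1) = arrivalTime s n + s n :=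
  Finset.sum_range_succ _ _

section Counting

variable {s : ℕ → ℝ}

lemma strictMono_arrivalTime (hs : ∀ n, 0 < s n) : StrictMono (arrivalTime s) :=
  strictMono_nat_of_lt_succ fun n => by linarith [arrivalTime_succ s n, hs n]

lemma arrivalTime_nonneg (hs : ∀ n, 0 < s n) (n : ℕ) : 0 ≤ arrivalTime s n :=
  Finset.sum_nonneg fun k _ => (hs k).le

lemma countingProcess_eq (hs : ∀ n, 0 < s n) {n : ℕ} {t : ℝ}
    (ht : t ∈ Ico (arrivalTime s n) (arrivalTime s (n + 1))) : countingProcess s t = n := by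
  have h : {m : ℕ | ∑ k ∈ Finset.range (m + 1), s k ≤ t} = (Finset.range n : Set ℕ) := by
    ext m
    change arrivalTime s (m + 1) ≤ t ↔ _
    simp only [Finset.coe_range, mem_Iio]
    constructor
    · intro hm
      exact Nat.lt_of_succ_lt_succ ((strictMono_arrivalTime hs).lt_iff_lt.1 (hm.trans_lt ht.2))
    · intro hm
      exact ((strictMono_arrivalTime hs).monotone hm).trans ht.1
  rw [countingProcess, h, ncard_coe_finset, Finset.card_range]

lemma exists_mem_Ico_arrivalTime (hlim : Tendsto (arrivalTime s) atTop atTop) {t : ℝ}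
    (ht : 0 ≤ t) : ∃ n, t ∈ Ico (arrivalTime s n) (arrivalTime s (n + 1)) := by
  classical
  have hex : ∃ n, t < arrivalTime s n := (hlim.eventually_gt_atTop t).exists
  obtain ⟨n, hn⟩ : ∃ n, Nat.find hex = n + 1 := by
    refine Nat.exists_eq_succ_of_ne_zero fun h0 => ?_
    have := Nat.find_spec hex
    rw [h0, arrivalTime_zero] at this
    linarith
  refine ⟨n, not_lt.1 (Nat.find_min hex (by omega)), hn ▸ Nat.find_spec hex⟩

end Counting

namespace CouplingMechanism

variable {X I E : Type*} [MeasurableSpace I] [MeasurableSpace E] {g : X → I → I → ℝ}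
  (C : CouplingMechanism E g)

/-! ### Paths of the coupled chains -/

/-- Both chains are driven by the same marks, so they stay together once they have met. -/
lemma jumpChain_eq_of_le {v : ℕ → E} {y z : I} {m n : ℕ} (hmn : m ≤ n)
    (h : C.jumpChain v y m = C.jumpChain v z m) : C.jumpChain v y n = C.jumpChain v z n := by
  induction n, hmn using Nat.le_induction with
  | base => exact h
  | succ n _ ih => simp [jumpChain, ih]

section Path

variable {C} {ω : (ℕ → ℝ) × (ℕ → E)} (hs : ∀ n, 0 < ω.1 n)
include hs

lemma chain_eq {y : I} {n : ℕ} {t : ℝ}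
    (ht : t ∈ Ico (arrivalTime ω.1 n) (arrivalTime ω.1 (n + 1))) :
    C.chain ω y t = C.jumpChain ω.2 y n := by
  rw [chain, countingProcess_eq hs ht]

variable (hlim : Tendsto (arrivalTime ω.1) atTop atTop)
include hlim

lemma couplingTime_eq_arrivalTime {y z : I} {M : ℕ}
    (hM : C.jumpChain ω.2 y M = C.jumpChain ω.2 z M)
    (hlt : ∀ n < M, C.jumpChain ω.2 y n ≠ C.jumpChain ω.2 z n) :
    C.couplingTime ω y z = ENNReal.ofReal (arrivalTime ω.1 M) := by
  apply le_antisymm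
  · have hmem : arrivalTime ω.1 M ∈ Ico (arrivalTime ω.1 M) (arrivalTime ω.1 (M + 1)) :=
      ⟨le_rfl, strictMono_arrivalTime hs (Nat.lt_succ_self M)⟩
    exact iInf₂_le _ ⟨arrivalTime_nonneg hs M, by rw [chain_eq hs hmem, chain_eq hs hmem, hM]⟩
  · refine le_iInf₂ fun t ht => ENNReal.ofReal_le_ofReal ?_
    obtain ⟨n, hn⟩ := exists_mem_Ico_arrivalTime hlim ht.1
    have h := ht.2
    rw [chain_eq hs hn, chain_eq hs hn] at h
    have hMn : M ≤ n := not_lt.1 fun hnM => hlt n hnM h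
    exact ((strictMono_arrivalTime hs).monotone hMn).trans hn.1

lemma couplingTime_eq_top {y z : I} (h : ∀ n, C.jumpChain ω.2 y n ≠ C.jumpChain ω.2 z n) :
    C.couplingTime ω y z = ⊤ := by
  simp only [couplingTime, iInf_eq_top]
  rintro t ⟨ht0, ht⟩
  obtain ⟨n, hn⟩ := exists_mem_Ico_arrivalTime hlim ht0
  rw [chain_eq hs hn, chain_eq hs hn] at ht
  exact absurd ht (h n)

open Classical in
/-- The coupling time is the sum of the holding times spent before the jump chains meet. -/
lemma couplingTime_eq_tsum (y z : I) :
    C.couplingTime ω y z = ∑' n, ENNReal.ofReal (ω.1 n) *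
      {v | C.jumpChain v y n ≠ C.jumpChain v z n}.indicator 1 ω.2 := by
  by_cases hex : ∃ n, C.jumpChain ω.2 y n = C.jumpChain ω.2 z n
  · rw [couplingTime_eq_arrivalTime hs hlim (Nat.find_spec hex) fun n hn => Nat.find_min hex hn,
      tsum_eq_sum (s := Finset.range (Nat.find hex)), arrivalTime,
      ENNReal.ofReal_sum_of_nonneg fun i _ => (hs i).le]
    · refine Finset.sum_congr rfl fun n hn => ?_
      have : C.jumpChain ω.2 y n ≠ C.jumpChain ω.2 z n :=
        Nat.find_min hex (Finset.mem_range.1 hn)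
      simp [this]
    · intro n hn
      have := C.jumpChain_eq_of_le (not_lt.1 fun h => hn (Finset.mem_range.2 h))
        (Nat.find_spec hex)
      simp [this]
  · push Not at hex
    have h1 : ∀ n, ENNReal.ofReal (ω.1 n) *
        {v | C.jumpChain v y n ≠ C.jumpChain v z n}.indicator 1 ω.2 = ENNReal.ofReal (ω.1 n) :=
      fun n => by simp [hex n]
    rw [couplingTime_eq_top hs hlim hex, tsum_congr h1]
    symm
    -- a convergent series of positive reals would keep the arrival times bounded
    by_contra hne
    have hsum : Summable ω.1 := by
      have := ENNReal.summable_toReal hne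
      simpa [ENNReal.toReal_ofReal (hs _).le] using this
    exact not_tendsto_nhds_of_tendsto_atTop hlim _ hsum.hasSum.tendsto_sum_nat

lemma beforeCoupling_eq {y z : I} {M : ℕ}
    (hM : C.jumpChain ω.2 y M = C.jumpChain ω.2 z M)
    (hlt : ∀ n < M, C.jumpChain ω.2 y n ≠ C.jumpChain ω.2 z n) :
    C.beforeCoupling ω y z = Ico 0 (arrivalTime ω.1 M) := by
  ext t
  simp only [beforeCoupling, couplingTime_eq_arrivalTime hs hlim hM hlt, mem_ofPred_eq, mem_Ico]
  refine and_congr_right fun ht => ?_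
  rw [ENNReal.ofReal_lt_ofReal_iff_of_nonneg ht]

variable {W : Type*} [NormedAddCommGroup W] [NormedSpace ℝ W] [CompleteSpace W]

omit hlim in
lemma integrableOn_and_setIntegral_Ico_arrivalTime (h : I → I → W) (y z : I) (M : ℕ) :
    IntegrableOn (fun t => h (C.chain ω y t) (C.chain ω z t)) (Ico 0 (arrivalTime ω.1 M)) ∧
    ∫ t in Ico 0 (arrivalTime ω.1 M), h (C.chain ω y t) (C.chain ω z t) =
      ∑ n ∈ Finset.range M, ω.1 n • h (C.jumpChain ω.2 y n) (C.jumpChain ω.2 z n) := by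
  induction M with
  | zero => simp [arrivalTime_zero]
  | succ M ih =>
    have hle := (strictMono_arrivalTime hs (Nat.lt_succ_self M)).le
    have hEq : EqOn (fun t => h (C.chain ω y t) (C.chain ω z t))
        (fun _ => h (C.jumpChain ω.2 y M) (C.jumpChain ω.2 z M))
        (Ico (arrivalTime ω.1 M) (arrivalTime ω.1 (M + 1))) := fun t ht => by
      simp only [chain_eq hs ht]
    have hint : IntegrableOn (fun t => h (C.chain ω y t) (C.chain ω z t))
        (Ico (arrivalTime ω.1 M) (arrivalTime ω.1 (M + 1))) := by
      rw [integrableOn_congr_fun hEq measurableSet_Ico]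
      exact integrableOn_const (by simp)
    rw [← Ico_union_Ico_eq_Ico (arrivalTime_nonneg hs M) hle]
    refine ⟨ih.1.union hint, ?_⟩
    rw [setIntegral_union (Ico_disjoint_Ico_same) measurableSet_Ico ih.1 hint, ih.2,
      Finset.sum_range_succ, setIntegral_congr_fun measurableSet_Ico hEq, setIntegral_const]
    simp [arrivalTime_succ, (hs M).le]

/-- On a path with finite coupling time, the time integral up to the coupling time is a sum over
the steps of the jump chains. -/
lemma integrableOn_and_hasSum_pathIntegral (f : X × I → W) (x : X) {y z : I}
    (hT : C.couplingTime ω y z ≠ ⊤) :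
    IntegrableOn (fun t => f (x, C.chain ω z t) - f (x, C.chain ω y t))
      (C.beforeCoupling ω y z) ∧
    HasSum (fun n => ω.1 n • (f (x, C.jumpChain ω.2 z n) - f (x, C.jumpChain ω.2 y n)))
      (C.pathIntegral f z x y ω) := by
  classical
  have hex : ∃ n, C.jumpChain ω.2 y n = C.jumpChain ω.2 z n := by
    by_contra h
    push Not at h
    exact hT (couplingTime_eq_top hs hlim h)
  have h := integrableOn_and_setIntegral_Ico_arrivalTime (C := C) hs
    (fun a b => f (x, b) - f (x, a)) y z (Nat.find hex)
  rw [pathIntegral, beforeCoupling_eq hs hlim (Nat.find_spec hex) fun n hn => Nat.find_min hex hn]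
  refine ⟨h.1, ?_⟩
  rw [h.2]
  refine hasSum_sum_of_ne_finset_zero fun n hn => ?_
  rw [C.jumpChain_eq_of_le (not_lt.1 fun h => hn (Finset.mem_range.2 h)) (Nat.find_spec hex),
    sub_self, smul_zero]

end Path

end CouplingMechanism

/-! ### Exponential holding times -/

lemma lintegral_ofReal_expMeasure {r : ℝ} (hr : 0 < r) :
    ∫⁻ t, ENNReal.ofReal t ∂expMeasure r = ENNReal.ofReal r⁻¹ := by
  -- `t` times the exponential density is `r⁻¹` times the density of the Gamma law of shape `2`
  have key : ∀ t, exponentialPDF r t * ENNReal.ofReal t =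
      ENNReal.ofReal r⁻¹ * gammaPDF 2 r t := by
    intro t
    rcases lt_or_ge t 0 with ht | ht
    · rw [exponentialPDF_of_neg ht, gammaPDF_of_neg ht, zero_mul, mul_zero]
    · rw [exponentialPDF_of_nonneg ht, gammaPDF_of_nonneg ht,
        ← ENNReal.ofReal_mul (by positivity), ← ENNReal.ofReal_mul (by positivity)]
      congr 1
      have h2 : Real.Gamma 2 = 1 := by simp
      have h1 : (2 : ℝ) - 1 = 1 := by norm_num
      rw [h2, h1, Real.rpow_one, Real.rpow_two]
      field_simp
  have hm : Measurable (exponentialPDF r) :=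
    (measurable_exponentialPDFReal r).ennreal_ofReal
  change ∫⁻ t, ENNReal.ofReal t ∂(volume.withDensity (exponentialPDF r)) = _
  rw [lintegral_withDensity_eq_lintegral_mul _ hm ENNReal.measurable_ofReal]
  simp only [Pi.mul_apply, key]
  have hg : Measurable (gammaPDF 2 r) := (measurable_gammaPDFReal 2 r).ennreal_ofReal
  rw [lintegral_const_mul _ hg, lintegral_gammaPDF_eq_one two_pos hr, mul_one]

lemma ae_pos_expMeasure {r : ℝ} (hr : 0 < r) : ∀ᵐ t ∂expMeasure r, 0 < t := by
  have := isProbabilityMeasure_expMeasure hr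
  have h := cdf_expMeasure_eq hr 0
  rw [cdf_eq_real] at h
  simp only [le_refl, if_true, mul_zero, neg_zero, Real.exp_zero, sub_self] at h
  rw [measureReal_eq_zero_iff] at h
  filter_upwards [measure_eq_zero_iff_ae_notMem.1 h] with t ht
  simpa using ht

lemma integral_id_expMeasure {r : ℝ} (hr : 0 < r) : ∫ t, t ∂expMeasure r = r⁻¹ := by
  rw [integral_eq_lintegral_of_nonneg_ae ((ae_pos_expMeasure hr).mono fun t ht => ht.le)
    measurable_id.aestronglyMeasurable, lintegral_ofReal_expMeasure hr,
    ENNReal.toReal_ofReal (by positivity)]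

/-- The law of the sequence of holding times of a Poisson process of rate `r`. -/
abbrev holdingLaw (r : ℝ) : Measure (ℕ → ℝ) := Measure.infinitePi fun _ => expMeasure r

lemma ae_pos_holdingLaw {r : ℝ} (hr : 0 < r) : ∀ᵐ s ∂holdingLaw r, ∀ n, 0 < s n := by
  have := isProbabilityMeasure_expMeasure hr
  rw [ae_all_iff]
  exact fun n => (measurePreserving_eval_infinitePi (fun _ : ℕ => expMeasure r)
    n).quasiMeasurePreserving.ae (ae_pos_expMeasure hr)

/-- Poisson processes do not explode: by the second Borel–Cantelli lemma, infinitely many holding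
times exceed `1`. -/
lemma ae_tendsto_arrivalTime {r : ℝ} (hr : 0 < r) :
    ∀ᵐ s ∂holdingLaw r, Tendsto (arrivalTime s) atTop atTop := by
  have := isProbabilityMeasure_expMeasure hr
  let A : ℕ → Set (ℕ → ℝ) := fun n => {s | 1 < s n}
  have hA : ∀ n, MeasurableSet (A n) := fun n =>
    measurableSet_lt measurable_const (measurable_pi_apply n)
  have hind : iIndepSet A (holdingLaw r) := by
    rw [iIndepSet_iff_meas_biInter hA]
    intro S
    have h := (iIndepFun_infinitePi (P := fun _ : ℕ => expMeasure r)
      (X := fun _ t => t) fun _ => measurable_id).measure_inter_preimage_eq_mul S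
      (sets := fun _ => Ioi 1) fun _ _ => measurableSet_Ioi
    exact h
  have hprob : ∀ n, holdingLaw r (A n) = expMeasure r (Ioi 1) := fun n =>
    (measurePreserving_eval_infinitePi (fun _ : ℕ => expMeasure r) n).measure_preimage
      measurableSet_Ioi.nullMeasurableSet
  have hpos : expMeasure r (Ioi 1) ≠ 0 := by
    intro h0
    have h1 := cdf_expMeasure_eq hr 1
    rw [cdf_eq_real, if_pos zero_le_one] at h1
    have h2 := probReal_add_probReal_compl (μ := expMeasure r) (measurableSet_Iic (a := (1 : ℝ)))
    rw [compl_Iic, measureReal_def _ (Ioi 1), h0, h1] at h2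
    have := Real.exp_pos (-(r * 1))
    simp at h2
  have hlim : holdingLaw r (limsup A atTop) = 1 := by
    refine measure_limsup_eq_one hA hind ?_
    simp only [hprob]
    exact ENNReal.tsum_const_eq_top_of_ne_zero hpos
  have hae : limsup A atTop ∈ ae (holdingLaw r) := by
    rw [mem_ae_iff_prob_eq_one₀ (MeasurableSet.measurableSet_limsup hA).nullMeasurableSet]
    exact hlim
  filter_upwards [hae, ae_pos_holdingLaw hr] with s hsA hs
  rw [mem_limsup_iff_frequently_mem] at hsA
  by_contra hnot
  -- a bounded sequence of arrival times would make the holding times tend to `0`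
  have hsum : Summable s := by
    by_contra hns
    exact hnot ((not_summable_iff_tendsto_nat_atTop_of_nonneg fun n => (hs n).le).1 hns)
  exact hsA ((hsum.tendsto_atTop_zero.eventually_lt_const one_pos).mono
    fun n hn => not_lt.2 (le_of_lt hn))

namespace CouplingMechanism

variable {X I E : Type*} [MeasurableSpace I] [MeasurableSpace E] {g : X → I → I → ℝ}
  (C : CouplingMechanism E g)

/-! ### The jump chain as a Markov chain -/

instance (x : X) : IsProbabilityMeasure (C.μ x) := C.isProbabilityMeasure_μ x

instance : IsProbabilityMeasure (expMeasure C.ν) := isProbabilityMeasure_expMeasure C.ν_pos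

/-- The law of the sequence of marks for the parameter `x`. -/
abbrev marksLaw (x : X) : Measure (ℕ → E) := Measure.infinitePi fun _ => C.μ x

instance (x : X) : IsProbabilityMeasure (C.law x) := by
  unfold law; infer_instance

lemma ae_law (x : X) :
    ∀ᵐ ω ∂C.law x, (∀ n, 0 < ω.1 n) ∧ Tendsto (arrivalTime ω.1) atTop atTop :=
  Measure.quasiMeasurePreserving_fst.ae
    ((ae_pos_holdingLaw C.ν_pos).and (ae_tendsto_arrivalTime C.ν_pos))

lemma measurable_F_apply (y : I) : Measurable (C.F y) :=
  C.measurable_F.comp measurable_prodMk_left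

lemma measurable_jumpChain (y : I) (n : ℕ) : Measurable fun v => C.jumpChain v y n := by
  induction n with
  | zero => exact measurable_const
  | succ n ih => exact C.measurable_F.comp (ih.prodMk (measurable_pi_apply n))

lemma jumpChain_congr {v w : ℕ → E} {n : ℕ} (h : ∀ i < n, v i = w i) (y : I) :
    C.jumpChain v y n = C.jumpChain w y n := by
  induction n with
  | zero => rfl
  | succ n ih => simp only [jumpChain, ih fun i hi => h i (by omega), h n (by omega)]

/-- The position of the jump chain after `n` steps is independent of the next mark. -/
lemma map_jumpChain_prodMk (x : X) (y : I) (n : ℕ) :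
    (C.marksLaw x).map (fun v => (C.jumpChain v y n, v n)) =
      ((C.marksLaw x).map fun v => C.jumpChain v y n).prod (C.μ x) := by
  classical
  obtain ⟨e⟩ : Nonempty E := (C.μ x).nonempty_of_neZero
  have hind := (iIndepFun_infinitePi (P := fun _ : ℕ => C.μ x) (X := fun _ e => e)
    fun _ => measurable_id).indepFun_finset (Finset.range n) {n} (by simp)
    fun i => measurable_pi_apply i
  -- the first `n` marks, extended by a constant, determine the `n`-th position
  let ext : (Finset.range n → E) → ℕ → E := fun w i =>
    if h : i ∈ Finset.range n then w ⟨i, h⟩ else e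
  have hext : Measurable ext := by
    refine measurable_pi_lambda _ fun i => ?_
    by_cases h : i ∈ Finset.range n
    · simpa only [ext, dif_pos h] using measurable_pi_apply _
    · simpa only [ext, dif_neg h] using measurable_const
  have hind2 := hind.comp ((C.measurable_jumpChain y n).comp hext)
    (measurable_pi_apply (⟨n, Finset.mem_singleton_self n⟩ : ({n} : Finset ℕ)))
  have h1 : (fun v => C.jumpChain v y n) =
      ((fun v => C.jumpChain v y n) ∘ ext) ∘ fun (v : ℕ → E) (i : Finset.range n) => v i := by
    funext v
    refine C.jumpChain_congr (fun i hi => ?_) y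
    simp [ext, hi]
  have hind3 : IndepFun (fun v => C.jumpChain v y n) (fun v : ℕ → E => v n) (C.marksLaw x) := by
    rw [h1]; exact hind2
  rw [hind3.map_prod_eq_prod_map_map (C.measurable_jumpChain y n).aemeasurable
    (measurable_pi_apply n).aemeasurable, Measure.infinitePi_map_eval]

variable {W : Type*} [NormedAddCommGroup W] [NormedSpace ℝ W]

/-- The one-step transition operator `h ↦ 𝔼 h(F(·, V))` of the jump chain, with `V` of law
`μ_x`. -/
def transition (x : X) (h : I → W) (y : I) : W := ∫ v, h (C.F y v) ∂C.μ x

variable [Countable I] [DiscreteMeasurableSpace I]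

omit [NormedSpace ℝ W] in
lemma integrable_comp_F {B : ℝ} {h : I → W} (hB : ∀ y, ‖h y‖ ≤ B) (x : X) (y : I) :
    Integrable (fun v => h (C.F y v)) (C.μ x) :=
  .of_bound ((StronglyMeasurable.of_discrete (f := h)).comp_measurable
    (C.measurable_F_apply y)).aestronglyMeasurable B (.of_forall fun _ => hB _)

omit [NormedSpace ℝ W] in
lemma integrable_comp_jumpChain {B : ℝ} {h : I → W} (hB : ∀ y, ‖h y‖ ≤ B) (x : X) (y : I)
    (n : ℕ) : Integrable (fun v => h (C.jumpChain v y n)) (C.marksLaw x) :=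
  .of_bound ((StronglyMeasurable.of_discrete (f := h)).comp_measurable
    (C.measurable_jumpChain y n)).aestronglyMeasurable B (.of_forall fun _ => hB _)

omit [Countable I] [DiscreteMeasurableSpace I] in
lemma norm_transition_le {B : ℝ} {h : I → W} (hB : ∀ y, ‖h y‖ ≤ B) (x : X) (y : I) :
    ‖C.transition x h y‖ ≤ B := by
  simpa [transition] using norm_integral_le_of_norm_le_const (μ := C.μ x)
    (.of_forall fun v => hB (C.F y v))

omit [Countable I] [DiscreteMeasurableSpace I] in
lemma norm_transition_iterate_le {B : ℝ} {h : I → W} (hB : ∀ y, ‖h y‖ ≤ B) (x : X) (n : ℕ)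
    (y : I) : ‖(C.transition x)^[n] h y‖ ≤ B := by
  induction n generalizing h with
  | zero => exact hB y
  | succ n ih => exact ih fun y => C.norm_transition_le hB x y

lemma integral_jumpChain_succ {B : ℝ} {h : I → W} (hB : ∀ y, ‖h y‖ ≤ B) (x : X) (y : I) (n : ℕ) :
    ∫ v, h (C.jumpChain v y (n + 1)) ∂C.marksLaw x =
      ∫ v, C.transition x h (C.jumpChain v y n) ∂C.marksLaw x := by
  have hZ := C.measurable_jumpChain y n
  have : IsProbabilityMeasure ((C.marksLaw x).map fun v => C.jumpChain v y n) :=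
    Measure.isProbabilityMeasure_map hZ.aemeasurable
  have hm : StronglyMeasurable fun p : I × E => h (C.F p.1 p.2) :=
    (StronglyMeasurable.of_discrete (f := h)).comp_measurable C.measurable_F
  calc ∫ v, h (C.jumpChain v y (n + 1)) ∂C.marksLaw x
      = ∫ p, h (C.F p.1 p.2) ∂((C.marksLaw x).map fun v => (C.jumpChain v y n, v n)) := by
        rw [integral_map (hZ.prodMk (measurable_pi_apply n)).aemeasurable
          hm.aestronglyMeasurable]
        rfl
    _ = ∫ z, C.transition x h z ∂((C.marksLaw x).map fun v => C.jumpChain v y n) := by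
        rw [C.map_jumpChain_prodMk, integral_prod]
        · rfl
        · exact .of_bound hm.aestronglyMeasurable B (.of_forall fun _ => hB _)
    _ = _ := integral_map hZ.aemeasurable StronglyMeasurable.of_discrete.aestronglyMeasurable

/-- Expectations along the jump chain are given by the powers of the transition operator. -/
lemma integral_jumpChain [CompleteSpace W] {B : ℝ} {h : I → W} (hB : ∀ y, ‖h y‖ ≤ B) (x : X)
    (y : I) (n : ℕ) :
    ∫ v, h (C.jumpChain v y n) ∂C.marksLaw x = (C.transition x)^[n] h y := by
  induction n generalizing h with
  | zero => simp [jumpChain]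
  | succ n ih =>
    rw [C.integral_jumpChain_succ hB, ih fun y => C.norm_transition_le hB x y,
      Function.iterate_succ_apply]

/-! ### The mean coupling time -/

/-- The probability that the jump chains started from `y` and `z` have not met after `n` steps. -/
def uncoupledProb (x : X) (y z : I) (n : ℕ) : ℝ :=
  (C.marksLaw x).real {v | C.jumpChain v y n ≠ C.jumpChain v z n}

lemma measurableSet_uncoupled (y z : I) (n : ℕ) :
    MeasurableSet {v | C.jumpChain v y n ≠ C.jumpChain v z n} :=
  (measurableSet_eq_fun (C.measurable_jumpChain y n) (C.measurable_jumpChain z n)).compl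

lemma measurable_fst_apply (n : ℕ) :
    Measurable fun ω : (ℕ → ℝ) × (ℕ → E) => ω.1 n :=
  (measurable_pi_apply n).comp measurable_fst

lemma meanCouplingTime_eq_tsum (x : X) (y z : I) :
    C.meanCouplingTime x y z =
      ∑' n, ENNReal.ofReal (C.ν⁻¹ * C.uncoupledProb x y z n) := by
  rw [meanCouplingTime, lintegral_congr_ae
    ((C.ae_law x).mono fun ω hω => couplingTime_eq_tsum hω.1 hω.2 y z), lintegral_tsum]
  · refine tsum_congr fun n => ?_
    have h1 : ∫⁻ s, ENNReal.ofReal (s n) ∂holdingLaw C.ν = ENNReal.ofReal C.ν⁻¹ := by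
      rw [← lintegral_ofReal_expMeasure C.ν_pos]
      exact (measurePreserving_eval_infinitePi (fun _ : ℕ => expMeasure C.ν) n).lintegral_comp
        ENNReal.measurable_ofReal
    rw [law, lintegral_prod_mul (f := fun s : ℕ → ℝ => ENNReal.ofReal (s n))
      (measurable_pi_apply n).ennreal_ofReal.aemeasurable
      (measurable_one.indicator (C.measurableSet_uncoupled y z n)).aemeasurable, h1,
      lintegral_indicator_one (C.measurableSet_uncoupled y z n),
      ENNReal.ofReal_mul (inv_nonneg.2 C.ν_pos.le), uncoupledProb, ofReal_measureReal]
  · exact fun n => ((measurable_fst_apply n).ennreal_ofReal.mul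
      ((measurable_one.indicator (C.measurableSet_uncoupled y z n)).comp
        measurable_snd)).aemeasurable

omit [Countable I] [DiscreteMeasurableSpace I] in
lemma uncoupledProb_nonneg (x : X) (y z : I) (n : ℕ) : 0 ≤ C.uncoupledProb x y z n :=
  measureReal_nonneg

lemma summable_uncoupledProb {x : X} {y z : I} {τ : ℝ} (hτ : 0 < τ)
    (hm : C.meanCouplingTime x y z ≤ ENNReal.ofReal τ) :
    Summable (C.uncoupledProb x y z) ∧ ∑' n, C.uncoupledProb x y z n ≤ C.ν * τ := by
  have h0 : ∀ n, 0 ≤ C.ν⁻¹ * C.uncoupledProb x y z n := fun n =>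
    mul_nonneg (inv_nonneg.2 C.ν_pos.le) (C.uncoupledProb_nonneg x y z n)
  rw [meanCouplingTime_eq_tsum] at hm
  have hsum : Summable fun n => C.ν⁻¹ * C.uncoupledProb x y z n := by
    have := ENNReal.summable_toReal (ne_top_of_le_ne_top ENNReal.ofReal_ne_top hm)
    simpa only [ENNReal.toReal_ofReal (h0 _)] using this
  refine ⟨(summable_mul_left_iff (inv_ne_zero C.ν_pos.ne')).1 hsum, ?_⟩
  rw [← ENNReal.ofReal_tsum_of_nonneg h0 hsum, ENNReal.ofReal_le_ofReal_iff hτ.le,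
    tsum_mul_left, inv_mul_le_iff₀ C.ν_pos] at hm
  exact hm

/-- The path integral is integrable, and its mean is a series over the steps of the jump chain,
each step contributing the mean holding time `ν⁻¹`. -/
lemma integrable_and_hasSum_couplingCorrector [CompleteSpace W] {x : X} {y z : I} {τ : ℝ}
    (hm : C.meanCouplingTime x y z ≤ ENNReal.ofReal τ) {f : X × I → W} {B : ℝ}
    (hB : ∀ p, ‖f p‖ ≤ B) :
    (∀ᵐ ω ∂C.law x, IntegrableOn (fun t => f (x, C.chain ω z t) - f (x, C.chain ω y t))
      (C.beforeCoupling ω y z)) ∧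
    Integrable (C.pathIntegral f z x y) (C.law x) ∧
    HasSum (fun n => C.ν⁻¹ • ((C.transition x)^[n] (fun y => f (x, y)) z -
      (C.transition x)^[n] (fun y => f (x, y)) y)) (C.couplingCorrector f z x y) := by
  have hBx : ∀ y, ‖f (x, y)‖ ≤ B := fun y => hB _
  have hB0 : 0 ≤ B := (norm_nonneg _).trans (hBx y)
  let D : ℕ → Set (ℕ → E) := fun n => {v | C.jumpChain v y n ≠ C.jumpChain v z n}
  have hD : ∀ n, MeasurableSet (D n) := C.measurableSet_uncoupled y z
  let T : ℕ → (ℕ → ℝ) × (ℕ → E) → ℝ := fun n ω => ω.1 n * (D n).indicator 1 ω.2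
  let G : ℕ → (ℕ → ℝ) × (ℕ → E) → W := fun n ω =>
    ω.1 n • (f (x, C.jumpChain ω.2 z n) - f (x, C.jumpChain ω.2 y n))
  have hTofReal : ∀ n (ω : (ℕ → ℝ) × (ℕ → E)), ENNReal.ofReal (T n ω) =
      ENNReal.ofReal (ω.1 n) * (D n).indicator 1 ω.2 := by
    intro n ω
    by_cases h : ω.2 ∈ D n <;> simp [T, h]
  have hTm : ∀ n, Measurable (T n) := fun n => (measurable_fst_apply n).mul
    ((measurable_one.indicator (hD n)).comp measurable_snd)
  have hT0 : ∀ ω : (ℕ → ℝ) × (ℕ → E), (∀ n, 0 < ω.1 n) → ∀ n, 0 ≤ T n ω := fun ω hω n =>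
    mul_nonneg (hω n).le (indicator_nonneg (fun _ _ => zero_le_one) _)
  have hlt : ∫⁻ ω, C.couplingTime ω y z ∂C.law x < ⊤ := hm.trans_lt ENNReal.ofReal_lt_top
  have hTc : ∀ᵐ ω ∂C.law x, C.couplingTime ω y z = ∑' n, ENNReal.ofReal (T n ω) :=
    (C.ae_law x).mono fun ω hω => by
      simp only [hTofReal]; exact couplingTime_eq_tsum hω.1 hω.2 y z
  have hTfin : ∀ᵐ ω ∂C.law x, ∑' n, ENNReal.ofReal (T n ω) < ⊤ := by
    refine ae_lt_top (Measurable.tsum fun n => (hTm n).ennreal_ofReal) ?_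
    rw [← lintegral_congr_ae hTc]
    exact hlt.ne
  have hTsum : ∀ᵐ ω ∂C.law x, Summable fun n => T n ω := by
    filter_upwards [hTfin, C.ae_law x] with ω h1 h2
    simpa only [ENNReal.toReal_ofReal (hT0 ω h2.1 _)] using ENNReal.summable_toReal h1.ne
  have hTint : Integrable (fun ω => ∑' n, T n ω) (C.law x) := by
    refine ⟨(Measurable.tsum hTm).aestronglyMeasurable, ?_⟩
    rw [hasFiniteIntegral_iff_ofReal ((C.ae_law x).mono fun ω hω => tsum_nonneg (hT0 ω hω.1))]
    refine lt_of_le_of_lt (le_of_eq (lintegral_congr_ae ?_)) hlt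
    filter_upwards [hTc, hTsum, C.ae_law x] with ω h1 h2 h3
    rw [h1, ENNReal.ofReal_tsum_of_nonneg (hT0 ω h3.1) h2]
  have hGm : ∀ n, StronglyMeasurable (G n) := fun n => by
    have hf : StronglyMeasurable fun y => f (x, y) := .of_discrete
    exact (measurable_fst_apply n).stronglyMeasurable.smul
      ((hf.comp_measurable ((C.measurable_jumpChain z n).comp measurable_snd)).sub
        (hf.comp_measurable ((C.measurable_jumpChain y n).comp measurable_snd)))
  have hGle : ∀ n, ∀ᵐ ω ∂C.law x, ‖G n ω‖ ≤ 2 * B * T n ω := fun n =>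
    (C.ae_law x).mono fun ω hω => by
      by_cases h : ω.2 ∈ D n
      · have h1 := norm_sub_le_of_le (hBx (C.jumpChain ω.2 z n)) (hBx (C.jumpChain ω.2 y n))
        have h2 : T n ω = ω.1 n := by simp [T, h]
        rw [h2, norm_smul, Real.norm_of_nonneg (hω.1 n).le]
        nlinarith [hω.1 n]
      · have h1 : C.jumpChain ω.2 y n = C.jumpChain ω.2 z n := not_not.1 h
        simp [G, T, h, h1]
  have hpath : ∀ᵐ ω ∂C.law x,
      IntegrableOn (fun t => f (x, C.chain ω z t) - f (x, C.chain ω y t))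
        (C.beforeCoupling ω y z) ∧ HasSum (fun n => G n ω) (C.pathIntegral f z x y ω) := by
    filter_upwards [hTc, hTfin, C.ae_law x] with ω h1 h2 h3
    exact integrableOn_and_hasSum_pathIntegral h3.1 h3.2 f x (h1 ▸ h2.ne)
  refine ⟨hpath.mono fun ω h => h.1, ?_, ?_⟩
  · refine (hTint.const_mul (2 * B)).mono' ?_ ?_
    · exact aestronglyMeasurable_of_tendsto_ae atTop
        (fun n => (Finset.stronglyMeasurable_fun_sum (Finset.range n)
          fun i _ => hGm i).aestronglyMeasurable)
        (hpath.mono fun ω h => h.2.tendsto_sum_nat)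
    · filter_upwards [hpath, hTsum, ae_all_iff.2 hGle] with ω h1 h2 h3
      rw [← h1.2.tsum_eq, ← tsum_mul_left]
      exact tsum_of_norm_bounded (h2.mul_left (2 * B)).hasSum h3
  · have h := hasSum_integral_of_dominated_convergence (μ := C.law x)
      (fun n ω => 2 * B * T n ω) (fun n => (hGm n).aestronglyMeasurable) hGle
      (hTsum.mono fun ω h => h.mul_left _)
      (by simpa only [tsum_mul_left] using hTint.const_mul (2 * B)) (hpath.mono fun ω h => h.2)
    rw [couplingCorrector]
    convert h using 2 with n
    have hν : ∫ s, s n ∂holdingLaw C.ν = C.ν⁻¹ := by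
      rw [← integral_id_expMeasure C.ν_pos]
      conv_rhs => rw [← Measure.infinitePi_map_eval (fun _ : ℕ => expMeasure C.ν) n]
      exact (integral_map (φ := fun s : ℕ → ℝ => s n) (f := fun t => t)
        (measurable_pi_apply n).aemeasurable measurable_id.aestronglyMeasurable).symm
    have hprod := integral_prod_smul (μ := holdingLaw C.ν) (ν := C.marksLaw x) (fun s => s n)
      fun v => f (x, C.jumpChain v z n) - f (x, C.jumpChain v y n)
    rw [hν, integral_sub (C.integrable_comp_jumpChain hBx x z n)
      (C.integrable_comp_jumpChain hBx x y n), C.integral_jumpChain hBx, C.integral_jumpChain hBx]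
      at hprod
    exact hprod.symm

end CouplingMechanism

/-! ### Total variation and integrals -/

/-- Against a difference of probability measures, a function of oscillation at most `K` integrates
to at most half the total variation times `K`: the positive and negative parts have the same
mass. -/
lemma norm_integral_sub_le_tvDist {E : Type*} [MeasurableSpace E] {W : Type*}
    [NormedAddCommGroup W] [NormedSpace ℝ W] [CompleteSpace W] (μ₁ μ₂ : Measure E)
    [IsProbabilityMeasure μ₁] [IsProbabilityMeasure μ₂] {φ : E → W} {B K : ℝ}
    (hφ : StronglyMeasurable φ) (hB : ∀ e, ‖φ e‖ ≤ B) (hK : ∀ a b, ‖φ a - φ b‖ ≤ K) :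
    ‖∫ e, φ e ∂μ₁ - ∫ e, φ e ∂μ₂‖ ≤ K / 2 * tvDist μ₁ μ₂ := by
  set s := μ₁.toSignedMeasure - μ₂.toSignedMeasure with hs
  set p := s.toJordanDecomposition.posPart with hp
  set q := s.toJordanDecomposition.negPart with hq
  have hint : ∀ (ρ : Measure E) [IsFiniteMeasure ρ], Integrable φ ρ := fun ρ _ =>
    .of_bound hφ.aestronglyMeasurable B (.of_forall hB)
  have hreal : ∀ A, MeasurableSet A → μ₁.real A - μ₂.real A = p.real A - q.real A := fun A hA => by
    rw [← s.apply_eq_posPart_real_sub_negPart_real hA, hs, Measure.toSignedMeasure_sub_apply hA]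
  have hmeas : μ₁ + q = μ₂ + p := by
    ext A hA
    rw [← ENNReal.toReal_eq_toReal_iff' (measure_ne_top _ _) (measure_ne_top _ _)]
    change (μ₁ + q).real A = (μ₂ + p).real A
    rw [measureReal_add_apply, measureReal_add_apply]
    linarith [hreal A hA]
  have hmass : p.real univ = q.real univ := by
    have := hreal univ MeasurableSet.univ
    rw [probReal_univ, probReal_univ] at this
    linarith
  have htv : tvDist μ₁ μ₂ = 2 * q.real univ := by
    change (p + q).real univ = _
    rw [measureReal_add_apply, hmass]
    ring
  have hdiff : ∫ e, φ e ∂μ₁ - ∫ e, φ e ∂μ₂ = ∫ e, φ e ∂p - ∫ e, φ e ∂q := by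
    have h := congrArg (fun ρ => ∫ e, φ e ∂ρ) hmeas
    simp only [integral_add_measure (hint _) (hint _)] at h
    rw [sub_eq_sub_iff_add_eq_add, h, add_comm]
  set m := q.real univ with hm
  have hm0 : 0 ≤ m := measureReal_nonneg
  have h1 : ∀ b, ‖∫ e, φ e ∂p - m • φ b‖ ≤ K * m := fun b => by
    have h : ∫ e, φ e ∂p - m • φ b = ∫ e, (φ e - φ b) ∂p := by
      rw [integral_sub (hint p) (integrable_const _), integral_const, hmass]
    rw [h, ← hmass]
    exact norm_integral_le_of_norm_le_const (.of_forall fun e => hK e b)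
  have h2 : ‖m • (∫ e, φ e ∂p - ∫ e, φ e ∂q)‖ ≤ K * m * m := by
    have h : m • (∫ e, φ e ∂p - ∫ e, φ e ∂q) = ∫ b, (∫ e, φ e ∂p - m • φ b) ∂q := by
      rw [integral_sub (integrable_const _) ((hint q).fun_smul m), integral_const, integral_smul,
        smul_sub]
    rw [h]
    exact norm_integral_le_of_norm_le_const (.of_forall h1)
  rw [hdiff, htv]
  rcases hm0.eq_or_lt with h0 | h0
  · have hq0 : q = 0 := by
      rw [← Measure.measure_univ_eq_zero, ← measureReal_eq_zero_iff, ← hm, ← h0]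
    have hp0 : p = 0 := by
      rw [← Measure.measure_univ_eq_zero, ← measureReal_eq_zero_iff, hmass, ← h0]
    simp [hp0, hq0, ← h0]
  · rw [norm_smul, Real.norm_of_nonneg hm0] at h2
    have : ‖∫ e, φ e ∂p - ∫ e, φ e ∂q‖ ≤ K * m := by
      refine le_of_mul_le_mul_left ?_ h0
      linarith
    linarith

namespace CouplingMechanism

variable {X I E : Type*} [MeasurableSpace I] [MeasurableSpace E] {g : X → I → I → ℝ}
  (C : CouplingMechanism E g) {W : Type*} [NormedAddCommGroup W] [NormedSpace ℝ W]
  [Countable I] [DiscreteMeasurableSpace I]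

/-! ### The generator -/

open Classical in
omit [Countable I] [DiscreteMeasurableSpace I] in
/-- The diagonal entries follow from the vanishing of the row sums. -/
lemma rate_eq_sub {x : X} (hg : IsGeneratorMatrix (g x)) {y : I}
    (hone : HasSum (fun y' => (C.μ x).real {v | C.F y v = y'}) 1) (y' : I) :
    g x y y' = C.ν * ((C.μ x).real {v | C.F y v = y'} - if y' = y then 1 else 0) := by
  rcases ne_or_eq y' y with h | rfl
  · rw [C.rate_eq x y y' h.symm, if_neg h, sub_zero]
  · have h1 := (hg.hasSum_row y').sub ((hone.sub (hasSum_ite_eq y' (1 : ℝ))).mul_left C.ν)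
    have h2 := h1.unique (hasSum_single y' fun z hz => by
      rw [C.rate_eq x y' z hz.symm, if_neg hz, sub_zero, sub_self])
    linarith

lemma hasSum_real_smul_transition [CompleteSpace W] {B : ℝ} {h : I → W} (hB : ∀ y, ‖h y‖ ≤ B)
    (x : X) (y : I) :
    HasSum (fun y' => (C.μ x).real {v | C.F y v = y'} • h y') (C.transition x h y) := by
  have hF := C.measurable_F_apply y
  have hint : Integrable h ((C.μ x).map (C.F y)) :=
    (integrable_map_measure StronglyMeasurable.of_discrete.aestronglyMeasurable
      hF.aemeasurable).2 (C.integrable_comp_F hB x y)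
  have h1 : C.transition x h y = ∫ z, h z ∂(C.μ x).map (C.F y) :=
    (integral_map hF.aemeasurable StronglyMeasurable.of_discrete.aestronglyMeasurable).symm
  rw [← Measure.sum_smul_dirac ((C.μ x).map (C.F y))] at hint h1
  have h2 := hasSum_integral_measure hint
  rw [← h1] at h2
  refine h2.congr_fun fun y' => ?_
  rw [integral_smul_measure, integral_dirac, Measure.map_apply hF (measurableSet_singleton _)]
  rfl

lemma hasSum_real_eq_one (x : X) (y : I) :
    HasSum (fun y' => (C.μ x).real {v | C.F y v = y'}) 1 := by
  have h := C.hasSum_real_smul_transition (h := fun _ => (1 : ℝ)) (B := 1) (by simp) x y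
  simpa [transition] using h

/-- On bounded functions the generator is `ν` times the transition operator minus the identity. -/
def generator (x : X) (h : I → W) (y : I) : W := C.ν • (C.transition x h y - h y)

lemma hasSum_generator [CompleteSpace W] {x : X} (hg : IsGeneratorMatrix (g x)) {B : ℝ}
    {h : I → W} (hB : ∀ y, ‖h y‖ ≤ B) (y : I) :
    HasSum (fun y' => g x y y' • h y') (C.generator x h y) := by
  classical
  refine (((C.hasSum_real_smul_transition hB x y).sub
    (hasSum_ite_eq y (h y))).const_smul C.ν).congr_fun fun y' => ?_
  rw [C.rate_eq_sub hg (C.hasSum_real_eq_one x y) y', mul_smul, sub_smul]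
  by_cases hy : y' = y <;> simp [hy]

omit [Countable I] [DiscreteMeasurableSpace I] in
lemma norm_generator_le {B : ℝ} {h : I → W} (hB : ∀ y, ‖h y‖ ≤ B) (x : X) (y : I) :
    ‖C.generator x h y‖ ≤ C.ν * (B + B) := by
  rw [generator, norm_smul, Real.norm_of_nonneg C.ν_pos.le]
  exact mul_le_mul_of_nonneg_left (norm_sub_le_of_le (C.norm_transition_le hB x y) (hB y))
    C.ν_pos.le

/-! ### Contraction by coupling -/

/-- The coupling inequality. -/
lemma norm_transition_iterate_sub_le [CompleteSpace W] {B K : ℝ} {h : I → W}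
    (hB : ∀ y, ‖h y‖ ≤ B) (hK : ∀ a b, ‖h a - h b‖ ≤ K) (x : X) (y z : I) (n : ℕ) :
    ‖(C.transition x)^[n] h z - (C.transition x)^[n] h y‖ ≤ K * C.uncoupledProb x y z n := by
  rw [← C.integral_jumpChain hB, ← C.integral_jumpChain hB,
    ← integral_sub (C.integrable_comp_jumpChain hB x z n) (C.integrable_comp_jumpChain hB x y n)]
  have hD := C.measurableSet_uncoupled y z n
  have h1 : ∫ v, {v | C.jumpChain v y n ≠ C.jumpChain v z n}.indicator (fun _ => K) v
      ∂C.marksLaw x = K * C.uncoupledProb x y z n := by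
    rw [integral_indicator_const _ hD, smul_eq_mul, mul_comm, uncoupledProb]
  rw [← h1]
  refine norm_integral_le_of_norm_le ((integrable_const K).indicator hD) (.of_forall fun v => ?_)
  by_cases hv : C.jumpChain v y n = C.jumpChain v z n
  · simp [hv]
  · simpa [hv] using hK _ _

lemma transition_iterate_generator [CompleteSpace W] {B : ℝ} {h : I → W} (hB : ∀ y, ‖h y‖ ≤ B)
    (x : X) (n : ℕ) (y : I) : (C.transition x)^[n] (C.generator x h) y =
      C.ν • ((C.transition x)^[n + 1] h y - (C.transition x)^[n] h y) := by
  have hPB : ∀ y, ‖C.transition x h y‖ ≤ B := fun y => C.norm_transition_le hB x y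
  rw [← C.integral_jumpChain fun y => C.norm_generator_le hB x y]
  simp only [generator]
  rw [integral_smul, integral_sub (C.integrable_comp_jumpChain hPB x y n)
    (C.integrable_comp_jumpChain hB x y n), C.integral_jumpChain hPB, C.integral_jumpChain hB,
    Function.iterate_succ_apply]

section

variable [CompleteSpace W] {x : X} {τ : ℝ} (hτ : 0 < τ)
  (hm : ∀ y z, C.meanCouplingTime x y z ≤ ENNReal.ofReal τ)
include hτ hm

lemma tendsto_uncoupledProb (y z : I) : Tendsto (C.uncoupledProb x y z) atTop (𝓝 0) :=
  (C.summable_uncoupledProb hτ (hm y z)).1.tendsto_atTop_zero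

lemma tendsto_transition_iterate_sub {B : ℝ} {h : I → W} (hB : ∀ y, ‖h y‖ ≤ B) (y z : I) :
    Tendsto (fun n => (C.transition x)^[n] h z - (C.transition x)^[n] h y) atTop (𝓝 0) :=
  squeeze_zero_norm (C.norm_transition_iterate_sub_le hB
    (fun a b => norm_sub_le_of_le (hB a) (hB b)) x y z)
    (by simpa using (C.tendsto_uncoupledProb hτ hm y z).const_mul (B + B))

omit [NormedSpace ℝ W] [CompleteSpace W] in
lemma sum_uncoupledProb_le (y z : I) (N : ℕ) :
    ∑ n ∈ Finset.range N, C.uncoupledProb x y z n ≤ C.ν * τ :=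
  ((C.summable_uncoupledProb hτ (hm y z)).1.sum_le_tsum _
    fun n _ => C.uncoupledProb_nonneg x y z n).trans (C.summable_uncoupledProb hτ (hm y z)).2

lemma norm_sum_transition_iterate_sub_le {B K : ℝ} {h : I → W} (hB : ∀ y, ‖h y‖ ≤ B)
    (hK : ∀ a b, ‖h a - h b‖ ≤ K) (y z : I) (N : ℕ) :
    ‖∑ n ∈ Finset.range N, C.ν⁻¹ • ((C.transition x)^[n] h z - (C.transition x)^[n] h y)‖ ≤
      τ * K := by
  have hν := C.ν_pos
  have hK0 : 0 ≤ K := (norm_nonneg _).trans (hK y y)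
  calc _ ≤ ∑ n ∈ Finset.range N, C.ν⁻¹ * (K * C.uncoupledProb x y z n) := by
        refine norm_sum_le_of_le _ fun n _ => ?_
        rw [norm_smul, Real.norm_of_nonneg (inv_nonneg.2 hν.le)]
        exact mul_le_mul_of_nonneg_left (C.norm_transition_iterate_sub_le hB hK x y z n)
          (inv_nonneg.2 hν.le)
    _ = C.ν⁻¹ * (K * ∑ n ∈ Finset.range N, C.uncoupledProb x y z n) := by
        rw [← Finset.mul_sum, ← Finset.mul_sum]
    _ ≤ C.ν⁻¹ * (K * (C.ν * τ)) := by
        gcongr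
        exact C.sum_uncoupledProb_le hτ hm y z N
    _ = τ * K := by field_simp

/-- The oscillation of a bounded function is at most `τ` times the oscillation of its image under
the generator. -/
lemma norm_sub_le_of_generator {B K : ℝ} {δ : I → W} (hB : ∀ y, ‖δ y‖ ≤ B)
    (hK : ∀ a b, ‖C.generator x δ a - C.generator x δ b‖ ≤ K) (y z : I) :
    ‖δ y - δ z‖ ≤ τ * K := by
  -- the resolvent series of the generator telescopes
  have htel : ∀ N, ∑ n ∈ Finset.range N, C.ν⁻¹ • ((C.transition x)^[n] (C.generator x δ) z -
      (C.transition x)^[n] (C.generator x δ) y) =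
      ((C.transition x)^[N] δ z - (C.transition x)^[N] δ y) + (δ y - δ z) := by
    intro N
    have h1 : ∀ n, C.ν⁻¹ • ((C.transition x)^[n] (C.generator x δ) z -
        (C.transition x)^[n] (C.generator x δ) y) =
        ((C.transition x)^[n + 1] δ z - (C.transition x)^[n + 1] δ y) -
          ((C.transition x)^[n] δ z - (C.transition x)^[n] δ y) := fun n => by
      rw [C.transition_iterate_generator hB, C.transition_iterate_generator hB, ← smul_sub,
        inv_smul_smul₀ C.ν_pos.ne']
      abel
    simp only [h1]
    rw [Finset.sum_range_sub fun n => (C.transition x)^[n] δ z - (C.transition x)^[n] δ y]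
    simp only [Function.iterate_zero, id]
    abel
  have hlim : Tendsto (fun N => ((C.transition x)^[N] δ z - (C.transition x)^[N] δ y) +
      (δ y - δ z)) atTop (𝓝 (δ y - δ z)) := by
    simpa using (C.tendsto_transition_iterate_sub hτ hm hB y z).add_const (δ y - δ z)
  refine le_of_tendsto hlim.norm (.of_forall fun N => ?_)
  rw [← htel]
  exact C.norm_sum_transition_iterate_sub_le hτ hm (fun y => C.norm_generator_le hB x y) hK y z N

/-- The potential `∑ ν⁻¹ (Pⁿ h(z) - Pⁿ h)` is bounded and solves the Poisson equation for `h`,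
centred at the common limit of the powers `Pⁿ h`. -/
lemma exists_generator_eq_sub {B : ℝ} {h χ : I → W} (hB : ∀ y, ‖h y‖ ≤ B) {z : I}
    (hχ : ∀ y, HasSum (fun n => C.ν⁻¹ • ((C.transition x)^[n] h z - (C.transition x)^[n] h y))
      (χ y)) :
    (∀ y, ‖χ y‖ ≤ τ * (B + B)) ∧
      ∃ c, (∀ y, Tendsto (fun n => (C.transition x)^[n] h y) atTop (𝓝 c)) ∧
        ∀ y, C.generator x χ y = h y - c := by
  let S : ℕ → I → W := fun N y =>
    ∑ n ∈ Finset.range N, C.ν⁻¹ • ((C.transition x)^[n] h z - (C.transition x)^[n] h y)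
  have hS : ∀ y, Tendsto (fun N => S N y) atTop (𝓝 (χ y)) := fun y => (hχ y).tendsto_sum_nat
  have hSB : ∀ N y, ‖S N y‖ ≤ τ * (B + B) := fun N y =>
    C.norm_sum_transition_iterate_sub_le hτ hm hB
      (fun a b => norm_sub_le_of_le (hB a) (hB b)) y z N
  have hPS : ∀ y, Tendsto (fun N => C.transition x (S N) y) atTop (𝓝 (C.transition x χ y)) :=
    fun y => tendsto_integral_of_dominated_convergence (fun _ => τ * (B + B))
      (fun N => (C.integrable_comp_F (hSB N) x y).aestronglyMeasurable) (integrable_const _)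
      (fun N => .of_forall fun v => hSB N _) (.of_forall fun v => hS _)
  have htel : ∀ N y, C.generator x (S N) y = h y - (C.transition x)^[N] h y := by
    intro N y
    have h1 : C.transition x (S N) y = ∑ n ∈ Finset.range N,
        C.ν⁻¹ • ((C.transition x)^[n] h z - (C.transition x)^[n + 1] h y) := by
      simp only [transition, S]
      rw [integral_finsetSum]
      · refine Finset.sum_congr rfl fun n _ => ?_
        rw [integral_smul, integral_sub (integrable_const _)
          (C.integrable_comp_F (C.norm_transition_iterate_le hB x n) x y),
          Function.iterate_succ_apply']
        simp [transition]
      · intro n _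
        exact ((integrable_const _).sub
          (C.integrable_comp_F (C.norm_transition_iterate_le hB x n) x y)).smul _
    have h2 : C.transition x (S N) y - S N y =
        C.ν⁻¹ • (h y - (C.transition x)^[N] h y) := by
      rw [h1, ← Finset.sum_sub_distrib, Finset.sum_congr rfl fun n _ => (smul_sub _ _ _).symm,
        ← Finset.smul_sum]
      congr 1
      simp only [sub_sub_sub_cancel_left]
      exact Finset.sum_range_sub' (fun n => (C.transition x)^[n] h y) N
    rw [generator, h2, smul_inv_smul₀ C.ν_pos.ne']
  have hlim : ∀ y, Tendsto (fun n => (C.transition x)^[n] h y) atTop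
      (𝓝 (h y - C.generator x χ y)) := by
    intro y
    have h1 := (((hPS y).sub (hS y)).const_smul C.ν).const_sub (h y)
    refine h1.congr fun N => ?_
    change h y - C.generator x (S N) y = _
    rw [htel, sub_sub_cancel]
  refine ⟨fun y => le_of_tendsto (hS y).norm (.of_forall fun N => hSB N y),
    h z - C.generator x χ z, fun y => ?_, fun y => ?_⟩
  · simpa using (hlim z).sub (C.tendsto_transition_iterate_sub hτ hm hB y z)
  · have h1 := tendsto_nhds_unique (hlim y)
      (by simpa using (hlim z).sub (C.tendsto_transition_iterate_sub hτ hm hB y z))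
    rw [← h1, sub_sub_cancel]

end

/-! ### The invariant distribution -/

section Invariant

/-- The measure on `I` with mass function `p`. -/
def massMeasure (p : I → ℝ) : Measure I :=
  Measure.sum fun y => ENNReal.ofReal (p y) • Measure.dirac y

omit [Countable I] [DiscreteMeasurableSpace I] in
lemma isProbabilityMeasure_massMeasure {p : I → ℝ} (h0 : ∀ y, 0 ≤ p y) (h1 : HasSum p 1) :
    IsProbabilityMeasure (massMeasure p) := by
  refine ⟨?_⟩
  rw [massMeasure, Measure.sum_apply _ MeasurableSet.univ]
  simp only [Measure.smul_apply, measure_univ, smul_eq_mul, mul_one]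
  rw [← ENNReal.ofReal_tsum_of_nonneg h0 h1.summable, h1.tsum_eq, ENNReal.ofReal_one]

lemma hasSum_smul_integral_massMeasure [CompleteSpace W] {p : I → ℝ} (h0 : ∀ y, 0 ≤ p y)
    (h1 : HasSum p 1) {B : ℝ} {h : I → W} (hB : ∀ y, ‖h y‖ ≤ B) :
    HasSum (fun y => p y • h y) (∫ y, h y ∂massMeasure p) := by
  have h2 := hasSum_integral_sum_dirac (c := fun y => ENNReal.ofReal (p y)) (x := id) (f := h)
    (fun _ => ENNReal.ofReal_ne_top) (by
      refine .of_nonneg_of_le (fun y => by positivity) (fun y => ?_) (h1.summable.mul_right B)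
      rw [ENNReal.toReal_ofReal (h0 y)]
      exact mul_le_mul_of_nonneg_left (hB y) (h0 y))
  simpa only [massMeasure, ENNReal.toReal_ofReal (h0 _), id] using h2

/-- A distribution that is invariant for the generator matrix is invariant for the jump chain. -/
lemma map_prod_massMeasure {x : X} (hg : IsGeneratorMatrix (g x)) {p : I → ℝ}
    (hp : IsInvariantDistribution (g x) p) :
    ((massMeasure p).prod (C.μ x)).map (Function.uncurry C.F) = massMeasure p := by
  classical
  have := isProbabilityMeasure_massMeasure hp.nonneg hp.hasSum_one
  refine Measure.ext_of_singleton fun y' => ?_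
  have hinv : HasSum (fun y => p y * (C.μ x).real {v | C.F y v = y'}) (p y') := by
    have h1 := ((hp.invariant y').mul_left C.ν⁻¹).add (hasSum_ite_eq y' (p y'))
    rw [mul_zero, zero_add] at h1
    refine h1.congr_fun fun y => ?_
    rw [C.rate_eq_sub hg (C.hasSum_real_eq_one x y) y']
    have := C.ν_pos.ne'
    rcases eq_or_ne y y' with rfl | hne
    · simp only [if_true]; field_simp; ring
    · rw [if_neg hne, if_neg hne.symm]; field_simp; ring
  rw [Measure.map_apply C.measurable_F (measurableSet_singleton _),
    Measure.prod_apply (C.measurable_F (measurableSet_singleton _)), massMeasure,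
    lintegral_sum_measure, Measure.sum_apply _ (measurableSet_singleton _)]
  simp only [lintegral_smul_measure, lintegral_dirac, Measure.smul_apply, smul_eq_mul]
  have h2 : ∀ y, ENNReal.ofReal (p y) * C.μ x (Prod.mk y ⁻¹' (Function.uncurry C.F ⁻¹' {y'})) =
      ENNReal.ofReal (p y * (C.μ x).real {v | C.F y v = y'}) := fun y => by
    rw [ENNReal.ofReal_mul (hp.nonneg y), ofReal_measureReal]
    rfl
  rw [tsum_congr h2, ← ENNReal.ofReal_tsum_of_nonneg
    (fun y => mul_nonneg (hp.nonneg y) measureReal_nonneg) hinv.summable, hinv.tsum_eq,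
    tsum_eq_single y' fun y hy => by simp [hy]]
  simp

lemma integral_transition_massMeasure {x : X} (hg : IsGeneratorMatrix (g x)) {p : I → ℝ}
    (hp : IsInvariantDistribution (g x) p) {B : ℝ} {h : I → W} (hB : ∀ y, ‖h y‖ ≤ B) :
    ∫ y, C.transition x h y ∂massMeasure p = ∫ y, h y ∂massMeasure p := by
  have := isProbabilityMeasure_massMeasure hp.nonneg hp.hasSum_one
  have hm : StronglyMeasurable fun q : I × E => h (C.F q.1 q.2) :=
    (StronglyMeasurable.of_discrete (f := h)).comp_measurable C.measurable_F
  conv_rhs => rw [← C.map_prod_massMeasure hg hp]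
  rw [integral_map C.measurable_F.aemeasurable
    StronglyMeasurable.of_discrete.aestronglyMeasurable]
  exact (integral_prod (fun q : I × E => h (C.F q.1 q.2))
    (.of_bound hm.aestronglyMeasurable B (.of_forall fun _ => hB _))).symm

lemma integral_transition_iterate_massMeasure {x : X} (hg : IsGeneratorMatrix (g x))
    {p : I → ℝ} (hp : IsInvariantDistribution (g x) p) {B : ℝ} {h : I → W}
    (hB : ∀ y, ‖h y‖ ≤ B) (n : ℕ) :
    ∫ y, (C.transition x)^[n] h y ∂massMeasure p = ∫ y, h y ∂massMeasure p := by
  induction n generalizing h with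
  | zero => rfl
  | succ n ih =>
    simp only [Function.iterate_succ_apply]
    rw [ih fun y => C.norm_transition_le hB x y, C.integral_transition_massMeasure hg hp hB]

/-- The limit of the powers of the transition operator is the mean under the invariant
distribution. -/
lemma hasSum_smul_of_tendsto [CompleteSpace W] {x : X} (hg : IsGeneratorMatrix (g x))
    {p : I → ℝ} (hp : IsInvariantDistribution (g x) p) {B : ℝ} {h : I → W}
    (hB : ∀ y, ‖h y‖ ≤ B) {c : W}
    (hc : ∀ y, Tendsto (fun n => (C.transition x)^[n] h y) atTop (𝓝 c)) :
    HasSum (fun y => p y • h y) c := by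
  have := isProbabilityMeasure_massMeasure hp.nonneg hp.hasSum_one
  have h1 : Tendsto (fun n => ∫ y, (C.transition x)^[n] h y ∂massMeasure p) atTop
      (𝓝 (∫ _, c ∂massMeasure p)) :=
    tendsto_integral_of_dominated_convergence (fun _ => B)
      (fun n => StronglyMeasurable.of_discrete.aestronglyMeasurable) (integrable_const _)
      (fun n => .of_forall fun y => C.norm_transition_iterate_le hB x n y) (.of_forall hc)
  simp only [C.integral_transition_iterate_massMeasure hg hp hB, integral_const, probReal_univ,
    one_smul] at h1
  rw [← tendsto_nhds_unique tendsto_const_nhds h1]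
  exact hasSum_smul_integral_massMeasure hp.nonneg hp.hasSum_one hB

end Invariant

/-! ### Regularity in the parameter -/

/-- The generators for two parameters differ by the total variation of the mark laws times half
the oscillation. -/
lemma norm_generator_sub_le [CompleteSpace W] {B K : ℝ} {h : I → W} (hB : ∀ y, ‖h y‖ ≤ B)
    (hK : ∀ a b, ‖h a - h b‖ ≤ K) (x x' : X) (y : I) :
    ‖C.generator x h y - C.generator x' h y‖ ≤
      C.ν * (K / 2 * tvDist (C.μ x) (C.μ x')) := by
  rw [generator, generator, ← smul_sub, sub_sub_sub_cancel_right, norm_smul,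
    Real.norm_of_nonneg C.ν_pos.le]
  exact mul_le_mul_of_nonneg_left (norm_integral_sub_le_tvDist (C.μ x) (C.μ x')
    ((StronglyMeasurable.of_discrete (f := h)).comp_measurable (C.measurable_F_apply y))
    (fun v => hB _) fun a b => hK _ _) C.ν_pos.le

lemma generator_sub [CompleteSpace W] {B B' : ℝ} {h h' : I → W} (hB : ∀ y, ‖h y‖ ≤ B)
    (hB' : ∀ y, ‖h' y‖ ≤ B') (x : X) (y : I) :
    C.generator x (fun y => h y - h' y) y = C.generator x h y - C.generator x h' y := by
  simp only [generator, transition]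
  rw [integral_sub (C.integrable_comp_F hB x y) (C.integrable_comp_F hB' x y), ← smul_sub]
  congr 1
  abel

/-- A family of bounded solutions of the Poisson equations that vanish at a common reference state
satisfies the corrector estimates. -/
lemma correctorEstimates_of_generator [CompleteSpace W] {τ : ℝ} (hτ : 0 < τ)
    (hm : ∀ x y z, C.meanCouplingTime x y z ≤ ENNReal.ofReal τ) {f : X × I → W}
    (hf : BddAbove (range fun p => ‖f p‖)) {χ : X → I → W} {z : I} (hz : ∀ x, χ x z = 0)
    {B : ℝ} (hB : ∀ x y, ‖χ x y‖ ≤ B) {c : X → W}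
    (hχ : ∀ x y, C.generator x (χ x) y = f (x, y) - c x) :
    C.CorrectorEstimates τ f χ := by
  have hfle : ∀ p, ‖f p‖ ≤ ⨆ p, ‖f p‖ := le_ciSup hf
  have hosc : ∀ x a b, ‖χ x a - χ x b‖ ≤ τ * ((⨆ p, ‖f p‖) + ⨆ p, ‖f p‖) := fun x =>
    C.norm_sub_le_of_generator hτ (hm x) (hB x) fun a b => by
      rw [hχ, hχ, sub_sub_sub_cancel_right]
      exact norm_sub_le_of_le (hfle _) (hfle _)
  refine ⟨fun x y => ?_, fun x x' y => ?_⟩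
  · have h := hosc x y z
    rw [hz, sub_zero] at h
    linarith
  · set Δ := ⨆ z, ‖f (x, z) - f (x', z)‖ with hΔ
    have hΔle : ∀ z, ‖f (x, z) - f (x', z)‖ ≤ Δ := le_ciSup ⟨_, by
      rintro _ ⟨z, rfl⟩
      exact norm_sub_le_of_le (hfle (x, z)) (hfle (x', z))⟩
    set R := C.ν * (τ * ((⨆ p, ‖f p‖) + ⨆ p, ‖f p‖) / 2 * tvDist (C.μ x) (C.μ x')) with hR
    have hRle := C.norm_generator_sub_le (hB x') (hosc x') x x'
    -- the image under the generator of the difference, up to an additive constant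
    have hgen : ∀ a, C.generator x (fun y => χ x y - χ x' y) a =
        (f (x, a) - f (x', a)) - (C.generator x (χ x') a - C.generator x' (χ x') a) +
          (c x' - c x) := fun a => by
      rw [C.generator_sub (hB x) (hB x'), hχ, hχ]
      abel
    have h := C.norm_sub_le_of_generator hτ (hm x) (δ := fun y => χ x y - χ x' y)
      (K := (Δ + R) + (Δ + R)) (fun y => norm_sub_le_of_le (hB x y) (hB x' y)) (fun a b => by
        rw [hgen, hgen, add_sub_add_right_eq_sub]
        exact norm_sub_le_of_le (norm_sub_le_of_le (hΔle a) (hRle a))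
          (norm_sub_le_of_le (hΔle b) (hRle b))) y z
    simp only [hz, sub_self, sub_zero] at h
    refine h.trans (le_of_eq ?_)
    rw [hR]
    ring

end CouplingMechanism

end FastVariable

end

theorem mainTheorem6 {d : ℕ} (U : Set (EuclideanSpace ℝ (Fin d)))
    {I : Type*} [Countable I] [MeasurableSpace I] [DiscreteMeasurableSpace I]
    {E : Type*} [MeasurableSpace E]
    (g : U → I → I → ℝ) (hg : ∀ x, FastVariable.IsGeneratorMatrix (g x))
    (π : U → I → ℝ) (hπ : ∀ x, FastVariable.IsInvariantDistribution (g x) (π x))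
    (hπ_unique : ∀ x p, FastVariable.IsInvariantDistribution (g x) p → p = π x)
    (C : FastVariable.CouplingMechanism E g)
    (τ : ℝ) (hτ : 0 < τ)
    (hm : ∀ x y ybar, C.meanCouplingTime x y ybar ≤ ENNReal.ofReal τ)
    {W : Type*} [NormedAddCommGroup W] [NormedSpace ℝ W] [FiniteDimensional ℝ W]
    [MeasurableSpace W] [BorelSpace W]
    (f : U × I → W) (hf : Measurable f) (hf_bdd : ∃ B : ℝ, ∀ p, ‖f p‖ ≤ B) :
    (∃ χ : U → I → W, FastVariable.IsCorrector g π f χ ∧ C.CorrectorEstimates τ f χ) ∧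
    ∀ ybar : I,
      C.CorrectorWellDefined f ybar ∧
      FastVariable.IsCorrector g π f (C.couplingCorrector f ybar) ∧
      C.CorrectorEstimates τ f (C.couplingCorrector f ybar) := by
  have : CompleteSpace W := FiniteDimensional.complete ℝ W
  obtain ⟨B, hB⟩ := hf_bdd
  have key : ∀ ybar : I, C.CorrectorWellDefined f ybar ∧
      FastVariable.IsCorrector g π f (C.couplingCorrector f ybar) ∧
      C.CorrectorEstimates τ f (C.couplingCorrector f ybar) := by
    intro z
    have hχ := fun x y => C.integrable_and_hasSum_couplingCorrector (hm x y z) hB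
    have hz : ∀ x, C.couplingCorrector f z x z = 0 := fun x => by
      rw [← (hχ x z).2.2.tsum_eq]
      simp
    have hsol := fun x => C.exists_generator_eq_sub hτ (hm x) (fun y => hB (x, y))
      fun y => (hχ x y).2.2
    choose hbdd c hlim hgen using hsol
    refine ⟨fun x y => ⟨(hχ x y).1, (hχ x y).2.1⟩, fun x => ⟨c x, ?_, fun y => ?_⟩, ?_⟩
    · exact C.hasSum_smul_of_tendsto (hg x) (hπ x) (fun y => hB (x, y)) (hlim x)
    · rw [← hgen]
      exact C.hasSum_generator (hg x) (hbdd x) y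
    · exact C.correctorEstimates_of_generator hτ hm
        ⟨B, by rintro _ ⟨p, rfl⟩; exact hB p⟩ hz hbdd hgen
  refine ⟨?_, key⟩
  rcases isEmpty_or_nonempty I with hI | ⟨⟨z⟩⟩
  · -- without states there are no parameters either, since the masses of `π` add up to `1`
    have hU : ∀ x : U, False := fun x => by
      simpa using (hπ x).hasSum_one.unique hasSum_empty
    exact ⟨fun _ => isEmptyElim, fun x => (hU x).elim, fun x => (hU x).elim,
      fun x => (hU x).elim⟩
  · exact ⟨_, (key z).2⟩
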